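/- Let $\mathcal H$ be a complex Hilbert space, let $T$ be a Jordan operator on $\mathcal H$, i.e. $T=M+N$ with $M,N$ bounded linear operators on $\mathcal H$, $M$ normal, $N$ nilpotent and $MN=NM$, and let $h\in\mathcal H$. Let $\Lambda_{T,h}$ be the linear functional on $\mathbb C[z,\bar z]$ determined by $$\Lambda_{T,h}(z^k\bar z^l)=\langle T^kh,T^lh\rangle_{\mathcal H},\qquad k,l\in\mathbb N_0$$ (the inner product being linear in the first variable). Then $\Lambda_{T,h}$ is a compactly supported distribution supported in the closed convex hull $K$ of the spectrum $\sigma(M)$. That is, there is a continuous linear functional $u$ on the Fréchet space $\mathscr C^\infty(\mathbb C)$ of smooth functions $\mathbb C=\mathbb R^2\to\mathbb C$ (with the topology of uniform convergence of all derivatives on compact sets) such that $u(p)=\Lambda_{T,h}(p)$ for all $p\in\mathbb C[z,\bar z]$ and $\operatorname{supp}u\subseteq K$. -/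

import Mathlib

open scoped ContDiff

noncomputable section

/-- The complex vector space of all smooth (real sense) functions `ℂ → ℂ`, where `ℂ = ℝ²`. -/
def smoothSubmodule : Submodule ℂ (ℂ → ℂ) where
  carrier := {f | ContDiff ℝ ∞ f}
  add_mem' hf hg := Set.mem_ofPred.2 ((Set.mem_ofPred.1 hf).add (Set.mem_ofPred.1 hg))
  zero_mem' := Set.mem_ofPred.2 contDiff_const
  smul_mem' c _ hf := Set.mem_ofPred.2 ((Set.mem_ofPred.1 hf).const_smul c)

/-- `𝒞^∞(ℂ)` as a type of its own, to carry the Fréchet topology below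
(and not the topology of pointwise convergence). -/
def SmoothFunction : Type := smoothSubmodule

namespace SmoothFunction

instance : AddCommGroup SmoothFunction := inferInstanceAs (AddCommGroup smoothSubmodule)

instance : Module ℂ SmoothFunction := inferInstanceAs (Module ℂ smoothSubmodule)

instance : FunLike SmoothFunction ℂ ℂ where
  coe f := f.1
  coe_injective _ _ h := Subtype.ext h

theorem contDiff (f : SmoothFunction) : ContDiff ℝ ∞ f := f.2

theorem contDiffAt (f : SmoothFunction) (n : ℕ) (x : ℂ) : ContDiffAt ℝ n f x :=
  (f.contDiff.of_le (by exact_mod_cast le_top)).contDiffAt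

theorem coe_add (f g : SmoothFunction) : ⇑(f + g) = ⇑f + ⇑g := rfl

theorem coe_smul (c : ℂ) (f : SmoothFunction) : ⇑(c • f) = c • ⇑f := rfl

/-- The `n`-th derivative of a smooth function, restricted to a compact set. -/
def derivOn (n : ℕ) (K : TopologicalSpace.Compacts ℂ) :
    SmoothFunction →ₗ[ℂ] C(K, ContinuousMultilinearMap ℝ (fun _ : Fin n => ℂ) ℂ) where
  toFun f :=
    { toFun := fun x => iteratedFDeriv ℝ n f x
      continuous_toFun :=
        (f.contDiff.continuous_iteratedFDeriv (by exact_mod_cast le_top)).comp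
          continuous_subtype_val }
  map_add' f g := by
    ext1 x
    exact iteratedFDeriv_add_apply (f.contDiffAt n x) (g.contDiffAt n x)
  map_smul' c f := by
    ext1 x
    exact iteratedFDeriv_const_smul_apply (f.contDiffAt n x)

/-- The seminorm `max {‖D^n f(x)‖ : n ≤ N, x ∈ K}` on `𝒞^∞(ℂ)`. -/
def smoothSeminorm : SeminormFamily ℂ SmoothFunction (ℕ × TopologicalSpace.Compacts ℂ) :=
  fun NK => (Finset.range (NK.1 + 1)).sup fun n =>
    (normSeminorm ℂ C(NK.2, ContinuousMultilinearMap ℝ (fun _ : Fin n => ℂ) ℂ)).comp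
      (derivOn n NK.2)

/-- The Fréchet topology of `𝒞^∞(ℂ)`, generated by the seminorms above. A compactly supported
distribution on `ℂ` is a continuous linear functional `SmoothFunction →L[ℂ] ℂ`. -/
instance : TopologicalSpace SmoothFunction := smoothSeminorm.moduleFilterBasis.topology

theorem withSeminorms : WithSeminorms smoothSeminorm := ⟨rfl⟩

end SmoothFunction

/-- The function `z ↦ p(z, z̄)` on `ℂ` is smooth; the variables `X 0`, `X 1` of `p` stand for
`z` and `z̄`. -/
theorem contDiff_evalConj (p : MvPolynomial (Fin 2) ℂ) :
    ContDiff ℝ ∞ fun z : ℂ => MvPolynomial.eval ![z, starRingEnd ℂ z] p := by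
  have h : ∀ i : Fin 2, ContDiff ℝ ∞ fun z : ℂ => (![z, starRingEnd ℂ z] : Fin 2 → ℂ) i := by
    intro i
    fin_cases i
    · exact contDiff_id
    · exact Complex.conjCLE.contDiff
  induction p using MvPolynomial.induction_on with
  | C a => simpa using contDiff_const
  | add p q hp hq => simpa using hp.add hq
  | mul_X p i hp => simpa using hp.mul (h i)

/-- The inclusion `ℂ[z, z̄] → 𝒞^∞(ℂ)`. -/
def polySmooth (p : MvPolynomial (Fin 2) ℂ) : SmoothFunction :=
  ⟨fun z => MvPolynomial.eval ![z, starRingEnd ℂ z] p, contDiff_evalConj p⟩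

section Agler

variable {H : Type*} [NormedAddCommGroup H] [InnerProductSpace ℂ H]

/-- The linear functional `Λ_{T,h}` on `ℂ[z, z̄]` with `Λ_{T,h}(z^k z̄^l) = ⟨T^k h, T^l h⟩`.
Mathlib's inner product is linear in the second variable, hence the order of the arguments. -/
def aglerFunctional (T : H →L[ℂ] H) (h : H) : MvPolynomial (Fin 2) ℂ →ₗ[ℂ] ℂ :=
  (MvPolynomial.basisMonomials (Fin 2) ℂ).constr ℂ
    fun α => inner ℂ ((T ^ α 1) h) ((T ^ α 0) h)

theorem aglerFunctional_X_pow_mul (T : H →L[ℂ] H) (h : H) (k l : ℕ) :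
    aglerFunctional T h (MvPolynomial.X 0 ^ k * MvPolynomial.X 1 ^ l) =
      inner ℂ ((T ^ l) h) ((T ^ k) h) := by
  have e : (MvPolynomial.X 0 ^ k * MvPolynomial.X 1 ^ l : MvPolynomial (Fin 2) ℂ) =
      MvPolynomial.basisMonomials (Fin 2) ℂ
        (Finsupp.single 0 k + Finsupp.single 1 l) := by
    simp [MvPolynomial.X_pow_eq_monomial, MvPolynomial.monomial_mul]
  rw [e, aglerFunctional, Module.Basis.constr_basis]
  simp

end Agler

/-- The linear functional `L` on `ℂ[z, z̄]` is a (compactly supported) distribution with support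
in `K`: it is the restriction to `ℂ[z, z̄]` of a continuous linear functional on `𝒞^∞(ℂ)` whose
support is contained in `K`. -/
def IsDistributionSupportedIn (L : MvPolynomial (Fin 2) ℂ →ₗ[ℂ] ℂ) (K : Set ℂ) : Prop :=
  ∃ u : SmoothFunction →L[ℂ] ℂ,
    (∀ p, L p = u (polySmooth p)) ∧ Distribution.dsupport u ⊆ K

/-- `T = M + N` exhibits `T` as a Jordan operator: `M` is normal, `N` is nilpotent and
`MN = NM`. -/
structure IsJordanDecomposition {H : Type*} [NormedAddCommGroup H] [InnerProductSpace ℂ H]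
    [CompleteSpace H] (T M N : H →L[ℂ] H) : Prop where
  eq_add : T = M + N
  normal : IsStarNormal M
  nilpotent : IsNilpotent N
  commute : M * N = N * M

end

/-!
For commuting `a` and `b` with `a` normal and `b ^ n = 0`, Taylor expansion of `f(z, z̄)` at `a`
suggests to define
`f(a + b) = ∑_{i, j < n} (b*)ʲ (∂ⁱ ∂̄ʲ f)(a) bⁱ / (i! j!)`,
where `(∂ⁱ ∂̄ʲ f)(a)` is given by the continuous functional calculus of the normal element `a`.
Since `f ↦ f(a)` is continuous for the sup norm on the compact set `σ(a)`, this is a distribution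
of finite order, and it lives on `σ(a)` because differentiation does not enlarge supports. On
`z ^ k * z̄ ^ l` it takes the value `((a + b) ^ l)* (a + b) ^ k` by the binomial theorem. Keeping
the powers of `b*` to the left and those of `b` to the right avoids commuting `b` with `a*` or `b*`.
For operators, the vector functional `X ↦ ⟨X h, h⟩` turns these values into the moments
`⟨T ^ k h, T ^ l h⟩`.
-/

noncomputable section

open Distribution LineDeriv MvPolynomial

open scoped Nat

section Algebra

theorem iterate_apply_eq_descFactorial_nsmul {G F : Type*} [AddCommMonoid G] [FunLike F G G]
    [AddMonoidHomClass F G G] (D : F) {x : ℕ → G} (hx : ∀ k, D (x k) = k • x (k - 1)) (i k : ℕ) :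
    D^[i] (x k) = k.descFactorial i • x (k - i) := by
  induction i with
  | zero => simp
  | succ i ih =>
    rw [Function.iterate_succ_apply', ih, map_nsmul, hx, smul_smul, Nat.descFactorial_succ,
      Nat.sub_sub, mul_comm]

theorem add_pow_eq_sum_range_of_pow_eq_zero {R : Type*} [Semiring R] {a b : R}
    (hab : Commute a b) {n : ℕ} (hb : b ^ n = 0) (k : ℕ) :
    (a + b) ^ k = ∑ i ∈ Finset.range n, k.choose i • (a ^ (k - i) * b ^ i) := by
  have hbinom : (a + b) ^ k = ∑ i ∈ Finset.range (k + 1), k.choose i • (a ^ (k - i) * b ^ i) := by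
    rw [add_comm, hab.symm.add_pow]
    refine Finset.sum_congr rfl fun i _ => ?_
    rw [nsmul_eq_mul, Nat.cast_comm, (hab.pow_pow _ _).eq]
  rw [hbinom]
  refine Finset.sum_congr_of_eq_on_inter (fun i _ hi => ?_) (fun i _ hi => ?_) fun _ _ _ => rfl
  · rw [pow_eq_zero_of_le (not_lt.1 (Finset.mem_range.not.1 hi)) hb, mul_zero, smul_zero]
  · rw [Nat.choose_eq_zero_of_lt (not_lt.1 (Finset.mem_range.not.1 hi)), zero_smul]

theorem inv_factorial_mul_descFactorial {K : Type*} [DivisionRing K] [CharZero K] (k i : ℕ) :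
    (i ! : K)⁻¹ * k.descFactorial i = k.choose i := by
  rw [Nat.descFactorial_eq_factorial_mul_choose, Nat.cast_mul,
    inv_mul_cancel_left₀ (Nat.cast_ne_zero.2 i.factorial_ne_zero)]

end Algebra

namespace SmoothFunction

theorem norm_iteratedFDeriv_le_smoothSeminorm (f : SmoothFunction) {n N : ℕ} (hn : n ≤ N)
    {K : TopologicalSpace.Compacts ℂ} {x : ℂ} (hx : x ∈ K) :
    ‖iteratedFDeriv ℝ n f x‖ ≤ smoothSeminorm (N, K) f :=
  (ContinuousMap.norm_coe_le_norm (derivOn n K f) ⟨x, hx⟩).trans <|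
    Seminorm.le_finset_sup_apply
      (p := fun n => (normSeminorm ℂ
        C(K, ContinuousMultilinearMap ℝ (fun _ : Fin n => ℂ) ℂ)).comp (derivOn n K))
      (Finset.mem_range.2 (Nat.lt_succ_of_le hn))

theorem norm_le_smoothSeminorm_zero (f : SmoothFunction) {K : TopologicalSpace.Compacts ℂ} {x : ℂ}
    (hx : x ∈ K) : ‖f x‖ ≤ smoothSeminorm (0, K) f := by
  simpa using f.norm_iteratedFDeriv_le_smoothSeminorm (le_refl 0) hx

theorem smoothSeminorm_le {f : SmoothFunction} {N : ℕ} {K : TopologicalSpace.Compacts ℂ} {C : ℝ}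
    (hC : 0 ≤ C) (h : ∀ n ≤ N, ∀ x ∈ K, ‖iteratedFDeriv ℝ n f x‖ ≤ C) :
    smoothSeminorm (N, K) f ≤ C :=
  Seminorm.finset_sup_apply_le hC fun n hn =>
    (ContinuousMap.norm_le _ hC).2 fun x =>
      h n (Nat.le_of_lt_succ (Finset.mem_range.1 hn)) x x.2

instance : IsTopologicalAddGroup SmoothFunction := withSeminorms.topologicalAddGroup

instance : ContinuousSMul ℂ SmoothFunction := withSeminorms.continuousSMul

theorem differentiableAt (f : SmoothFunction) (z : ℂ) : DifferentiableAt ℝ f z :=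
  f.contDiff.differentiable (by simp) z

theorem contDiff_fderiv (f : SmoothFunction) : ContDiff ℝ ∞ (fderiv ℝ f) :=
  f.contDiff.fderiv_right (by simp)

instance : LineDeriv ℂ SmoothFunction SmoothFunction where
  lineDerivOp v f := ⟨fun z => fderiv ℝ f z v, f.contDiff_fderiv.clm_apply contDiff_const⟩

theorem lineDerivOp_apply (v : ℂ) (f : SmoothFunction) (z : ℂ) :
    (∂_{v} f : SmoothFunction) z = fderiv ℝ f z v := rfl

instance : LineDerivAdd ℂ SmoothFunction SmoothFunction where
  lineDerivOp_add v f g := DFunLike.ext _ _ fun z => by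
    simp only [lineDerivOp_apply, coe_add, Pi.add_apply,
      fderiv_add (f.differentiableAt z) (g.differentiableAt z), add_apply]
  lineDerivOp_left_add v w f := DFunLike.ext _ _ fun z => map_add (fderiv ℝ f z) v w

instance : LineDerivSMul ℂ ℂ SmoothFunction SmoothFunction where
  lineDerivOp_smul v c f := DFunLike.ext _ _ fun z => by
    simp only [lineDerivOp_apply, coe_smul, Pi.smul_apply,
      fderiv_const_smul (f.differentiableAt z), smul_apply]

theorem smoothSeminorm_lineDerivOp_le (v : ℂ) (f : SmoothFunction) (N : ℕ)
    (K : TopologicalSpace.Compacts ℂ) :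
    smoothSeminorm (N, K) (∂_{v} f) ≤ ‖v‖ * smoothSeminorm (N + 1, K) f := by
  refine smoothSeminorm_le (mul_nonneg (norm_nonneg _) (apply_nonneg _ _)) fun n hn x hx => ?_
  calc ‖iteratedFDeriv ℝ n (∂_{v} f : SmoothFunction) x‖
      ≤ ‖v‖ * ‖iteratedFDeriv ℝ n (fderiv ℝ f) x‖ :=
        norm_iteratedFDeriv_clm_apply_const f.contDiff_fderiv.contDiffAt
          (by exact_mod_cast le_top)
    _ = ‖v‖ * ‖iteratedFDeriv ℝ (n + 1) f x‖ := by rw [norm_iteratedFDeriv_fderiv]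
    _ ≤ ‖v‖ * smoothSeminorm (N + 1, K) f := by
        gcongr
        exact f.norm_iteratedFDeriv_le_smoothSeminorm (Nat.succ_le_succ hn) hx

instance : ContinuousLineDeriv ℂ SmoothFunction SmoothFunction where
  continuous_lineDerivOp v := by
    let D : SmoothFunction →ₗ[ℂ] SmoothFunction :=
      { toFun := ∂_{v}, map_add' := lineDerivOp_add v, map_smul' := lineDerivOp_smul v }
    exact withSeminorms.continuous_of_isBounded withSeminorms D fun ⟨N, K⟩ =>
      ⟨{(N + 1, K)}, ‖v‖₊, fun f => by
        rw [Finset.sup_singleton]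
        exact smoothSeminorm_lineDerivOp_le v f N K⟩

/-- The local operators on `𝒞^∞(ℂ)`, those which do not enlarge supports. They form an algebra,
so that locality of a differential operator reduces to that of the directional derivatives. -/
def localOperators : Subalgebra ℂ (SmoothFunction →L[ℂ] SmoothFunction) where
  carrier := {D | ∀ f, tsupport (D f) ⊆ tsupport f}
  mul_mem' hD hE f := (hD _).trans (hE f)
  add_mem' hD hE f := (tsupport_add _ _).trans (Set.union_subset (hD f) (hE f))
  algebraMap_mem' c f := tsupport_smul_subset_right (fun _ => c) f

theorem lineDerivOpCLM_mem_localOperators (v : ℂ) :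
    lineDerivOpCLM ℂ SmoothFunction v ∈ localOperators :=
  fun _ => tsupport_fderiv_apply_subset ℝ v

/-- The Wirtinger derivative `∂ = (∂ₓ - i ∂_y) / 2`. -/
def wirtinger : SmoothFunction →L[ℂ] SmoothFunction :=
  (1 / 2 : ℂ) • (lineDerivOpCLM ℂ _ (1 : ℂ) - Complex.I • lineDerivOpCLM ℂ _ Complex.I)

/-- The conjugate Wirtinger derivative `∂̄ = (∂ₓ + i ∂_y) / 2`. -/
def wirtingerConj : SmoothFunction →L[ℂ] SmoothFunction :=
  (1 / 2 : ℂ) • (lineDerivOpCLM ℂ _ (1 : ℂ) + Complex.I • lineDerivOpCLM ℂ _ Complex.I)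

theorem wirtinger_mem_localOperators : wirtinger ∈ localOperators :=
  localOperators.smul_mem (sub_mem (lineDerivOpCLM_mem_localOperators _)
    (localOperators.smul_mem (lineDerivOpCLM_mem_localOperators _) _)) _

theorem wirtingerConj_mem_localOperators : wirtingerConj ∈ localOperators :=
  localOperators.smul_mem (add_mem (lineDerivOpCLM_mem_localOperators _)
    (localOperators.smul_mem (lineDerivOpCLM_mem_localOperators _) _)) _

theorem wirtinger_apply (f : SmoothFunction) (z : ℂ) :
    wirtinger f z = 1 / 2 * (fderiv ℝ f z 1 - Complex.I * fderiv ℝ f z Complex.I) := rfl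

theorem wirtingerConj_apply (f : SmoothFunction) (z : ℂ) :
    wirtingerConj f z = 1 / 2 * (fderiv ℝ f z 1 + Complex.I * fderiv ℝ f z Complex.I) := rfl

end SmoothFunction

section Polynomials

open SmoothFunction

/-- The inclusion `ℂ[z, z̄] → 𝒞^∞(ℂ)` as a linear map. -/
def polySmoothLinearMap : MvPolynomial (Fin 2) ℂ →ₗ[ℂ] SmoothFunction where
  toFun := polySmooth
  map_add' p q := DFunLike.ext _ _ fun z => map_add (eval ![z, starRingEnd ℂ z]) p q
  map_smul' c p := DFunLike.ext _ _ fun z => smul_eval ![z, starRingEnd ℂ z] p c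

theorem polySmooth_apply (p : MvPolynomial (Fin 2) ℂ) (z : ℂ) :
    polySmooth p z = eval ![z, starRingEnd ℂ z] p := rfl

theorem polySmooth_nsmul (n : ℕ) (p : MvPolynomial (Fin 2) ℂ) :
    polySmooth (n • p) = n • polySmooth p :=
  map_nsmul polySmoothLinearMap n p

theorem fderiv_polySmooth_X_apply (i : Fin 2) (z v : ℂ) :
    fderiv ℝ (polySmooth (X i)) z v = ![v, starRingEnd ℂ v] i := by
  fin_cases i
  · have hid : ⇑(polySmooth (X 0)) = id := by
      funext w
      simp [polySmooth_apply]
    simp [hid]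
  · have hconj : ⇑(polySmooth (X 1)) = Complex.conjCLE := by
      funext w
      simp [polySmooth_apply]
    change fderiv ℝ (polySmooth (X 1)) z v = starRingEnd ℂ v
    rw [hconj, ContinuousLinearEquiv.fderiv]
    rfl

theorem fderiv_polySmooth_apply (p : MvPolynomial (Fin 2) ℂ) (z v : ℂ) :
    fderiv ℝ (polySmooth p) z v =
      polySmooth (pderiv 0 p) z * v + polySmooth (pderiv 1 p) z * starRingEnd ℂ v := by
  induction p using MvPolynomial.induction_on with
  | C c =>
    have hconst : ⇑(polySmooth (C c)) = fun _ => c := by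
      funext w
      simp [polySmooth_apply]
    simp [hconst, polySmooth_apply]
  | add p q hp hq =>
    have hadd : ⇑(polySmooth (p + q)) = ⇑(polySmooth p) + ⇑(polySmooth q) := by
      funext w
      simp [polySmooth_apply]
    rw [hadd, fderiv_add (differentiableAt _ z) (differentiableAt _ z), add_apply, hp, hq]
    simp only [polySmooth_apply, map_add]
    ring
  | mul_X p i hp =>
    have hmul : ⇑(polySmooth (p * X i)) = ⇑(polySmooth p) * ⇑(polySmooth (X i)) := by
      funext w
      simp [polySmooth_apply]
    have hX : ![v, starRingEnd ℂ v] i =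
        polySmooth (pderiv 0 (X i)) z * v + polySmooth (pderiv 1 (X i)) z * starRingEnd ℂ v := by
      fin_cases i <;> simp [polySmooth_apply, pderiv_X]
    rw [hmul, fderiv_mul (differentiableAt _ z) (differentiableAt _ z), add_apply, smul_apply,
      smul_apply, hp, fderiv_polySmooth_X_apply, hX, pderiv_mul, pderiv_mul]
    simp only [polySmooth_apply, map_add, map_mul, smul_eq_mul]
    ring

theorem wirtinger_polySmooth (p : MvPolynomial (Fin 2) ℂ) :
    wirtinger (polySmooth p) = polySmooth (pderiv 0 p) := by
  refine DFunLike.ext _ _ fun z => ?_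
  rw [wirtinger_apply, fderiv_polySmooth_apply, fderiv_polySmooth_apply, map_one, Complex.conj_I]
  linear_combination (1 / 2 : ℂ) * (polySmooth (pderiv 1 p) z - polySmooth (pderiv 0 p) z) *
    Complex.I_mul_I

theorem wirtingerConj_polySmooth (p : MvPolynomial (Fin 2) ℂ) :
    wirtingerConj (polySmooth p) = polySmooth (pderiv 1 p) := by
  refine DFunLike.ext _ _ fun z => ?_
  rw [wirtingerConj_apply, fderiv_polySmooth_apply, fderiv_polySmooth_apply, map_one,
    Complex.conj_I]
  linear_combination (1 / 2 : ℂ) * (polySmooth (pderiv 0 p) z - polySmooth (pderiv 1 p) z) *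
    Complex.I_mul_I

theorem wirtinger_pow_polySmooth_monomial (i k l : ℕ) :
    (wirtinger ^ i) (polySmooth (X 0 ^ k * X 1 ^ l)) =
      k.descFactorial i • polySmooth (X 0 ^ (k - i) * X 1 ^ l) := by
  rw [FunLike.coe_pow_eq_iterate]
  refine iterate_apply_eq_descFactorial_nsmul wirtinger
    (x := fun k => polySmooth (X 0 ^ k * X 1 ^ l)) (fun k => ?_) i k
  rw [wirtinger_polySmooth, ← polySmooth_nsmul]
  rw [pderiv_mul, pderiv_pow, pderiv_pow, pderiv_X_self, pderiv_X_of_ne one_ne_zero, nsmul_eq_mul]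
  congr 1
  ring

theorem wirtingerConj_pow_polySmooth_monomial (j k l : ℕ) :
    (wirtingerConj ^ j) (polySmooth (X 0 ^ k * X 1 ^ l)) =
      l.descFactorial j • polySmooth (X 0 ^ k * X 1 ^ (l - j)) := by
  rw [FunLike.coe_pow_eq_iterate]
  refine iterate_apply_eq_descFactorial_nsmul wirtingerConj
    (x := fun l => polySmooth (X 0 ^ k * X 1 ^ l)) (fun l => ?_) j l
  rw [wirtingerConj_polySmooth, ← polySmooth_nsmul]
  rw [pderiv_mul, pderiv_pow, pderiv_pow, pderiv_X_self, pderiv_X_of_ne zero_ne_one, nsmul_eq_mul]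
  congr 1
  ring

theorem eq_comp_polySmooth_of_monomial {L : MvPolynomial (Fin 2) ℂ →ₗ[ℂ] ℂ}
    {u : SmoothFunction →L[ℂ] ℂ}
    (h : ∀ k l, L (X 0 ^ k * X 1 ^ l) = u (polySmooth (X 0 ^ k * X 1 ^ l)))
    (p : MvPolynomial (Fin 2) ℂ) : L p = u (polySmooth p) := by
  have hL : L = (u : SmoothFunction →ₗ[ℂ] ℂ) ∘ₗ polySmoothLinearMap := by
    refine (basisMonomials (Fin 2) ℂ).ext fun α => ?_
    simp only [coe_basisMonomials, monomial_fin_two, C_1, one_mul]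
    exact h _ _
  exact LinearMap.congr_fun hL p

theorem IsDistributionSupportedIn.mono {L : MvPolynomial (Fin 2) ℂ →ₗ[ℂ] ℂ} {K K' : Set ℂ}
    (hL : IsDistributionSupportedIn L K) (hK : K ⊆ K') : IsDistributionSupportedIn L K' :=
  let ⟨u, hu, hsupp⟩ := hL
  ⟨u, hu, hsupp.trans hK⟩

end Polynomials

section JordanCalculus

open SmoothFunction

variable {A : Type*} [CStarAlgebra A]

theorem norm_cfc_le_smoothSeminorm (a : A) (f : SmoothFunction) :
    ‖cfc f a‖ ≤ smoothSeminorm (0, ⟨spectrum ℂ a, spectrum.isCompact a⟩) f :=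
  norm_cfc_le (apply_nonneg _ _) fun _ hz => f.norm_le_smoothSeminorm_zero hz

/-- The continuous functional calculus `f ↦ f(a)` on smooth functions, as a linear map. As for
`cfc`, the value is the junk `0` if `a` is not normal. -/
def cfcSmoothLinearMap (a : A) : SmoothFunction →ₗ[ℂ] A where
  toFun f := cfc f a
  map_add' f g :=
    cfc_add a f g f.contDiff.continuous.continuousOn g.contDiff.continuous.continuousOn
  map_smul' c f := cfc_const_mul c f a f.contDiff.continuous.continuousOn

/-- The continuous functional calculus `f ↦ f(a)` as an `A`-valued distribution. -/
def cfcSmooth (a : A) : SmoothFunction →L[ℂ] A where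
  toLinearMap := cfcSmoothLinearMap a
  cont := withSeminorms.continuous_normedSpace_rng A (cfcSmoothLinearMap a)
    ⟨{(0, ⟨spectrum ℂ a, spectrum.isCompact a⟩)}, 1, fun f => by
      rw [Finset.sup_singleton, one_smul]
      exact norm_cfc_le_smoothSeminorm a f⟩

theorem cfcSmooth_apply (a : A) (f : SmoothFunction) : cfcSmooth a f = cfc f a := rfl

theorem isVanishingOn_cfcSmooth (a : A) : IsVanishingOn (cfcSmooth a) (spectrum ℂ a)ᶜ := by
  intro f hf
  have hzero : (spectrum ℂ a).EqOn f 0 := fun z hz =>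
    image_eq_zero_of_notMem_tsupport fun hz' => hf hz' hz
  rw [cfcSmooth_apply, cfc_congr hzero]
  exact cfc_zero ℂ a

theorem cfcSmooth_polySmooth_monomial (a : A) [IsStarNormal a] (k l : ℕ) :
    cfcSmooth a (polySmooth (X 0 ^ k * X 1 ^ l)) = star (a ^ l) * a ^ k := by
  have hcoe : ⇑(polySmooth (X 0 ^ k * X 1 ^ l)) = fun z : ℂ => star (z ^ l) * z ^ k := by
    funext z
    simp [polySmooth_apply, mul_comm]
  rw [cfcSmooth_apply, hcoe, cfc_mul (fun z : ℂ => star (z ^ l)) (fun z => z ^ k) a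
    (by fun_prop) (by fun_prop), cfc_star, cfc_pow_id a l, cfc_pow_id a k]

/-- The calculus `f ↦ f(a + b)` for a normal `a` and a commuting `b` with `b ^ n = 0`, as an
`A`-valued distribution: the Taylor expansion of `f` at `a`, where the powers of `b*` are placed on
the left and those of `b` on the right. -/
def jordanCalculus (a b : A) (n : ℕ) : SmoothFunction →L[ℂ] A :=
  ∑ j ∈ Finset.range n, ∑ i ∈ Finset.range n, ((j ! : ℂ)⁻¹ * (i ! : ℂ)⁻¹) •
    ContinuousLinearMap.mulLeftRight ℂ A (star (b ^ j)) (b ^ i) ∘L cfcSmooth a ∘L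
      (wirtinger ^ i * wirtingerConj ^ j)

theorem jordanCalculus_apply (a b : A) (n : ℕ) (f : SmoothFunction) :
    jordanCalculus a b n f = ∑ j ∈ Finset.range n, ∑ i ∈ Finset.range n,
      ((j ! : ℂ)⁻¹ * (i ! : ℂ)⁻¹) •
        (star (b ^ j) * cfcSmooth a ((wirtinger ^ i * wirtingerConj ^ j) f) * b ^ i) := by
  simp [jordanCalculus]

theorem isVanishingOn_jordanCalculus (a b : A) (n : ℕ) :
    IsVanishingOn (jordanCalculus a b n) (spectrum ℂ a)ᶜ := by
  intro f hf
  rw [jordanCalculus_apply]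
  refine Finset.sum_eq_zero fun j _ => Finset.sum_eq_zero fun i _ => ?_
  have hlocal : wirtinger ^ i * wirtingerConj ^ j ∈ localOperators :=
    mul_mem (pow_mem wirtinger_mem_localOperators i) (pow_mem wirtingerConj_mem_localOperators j)
  rw [isVanishingOn_cfcSmooth a _ ((hlocal f).trans hf), mul_zero, zero_mul, smul_zero]

theorem jordanCalculus_polySmooth_monomial {a b : A} [IsStarNormal a] (hab : Commute a b) {n : ℕ}
    (hb : b ^ n = 0) (k l : ℕ) :
    jordanCalculus a b n (polySmooth (X 0 ^ k * X 1 ^ l)) = star ((a + b) ^ l) * (a + b) ^ k := by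
  rw [jordanCalculus_apply, add_pow_eq_sum_range_of_pow_eq_zero hab hb,
    add_pow_eq_sum_range_of_pow_eq_zero hab hb, star_sum, Finset.sum_mul_sum]
  refine Finset.sum_congr rfl fun j _ => Finset.sum_congr rfl fun i _ => ?_
  rw [mul_apply_eq_comp, wirtingerConj_pow_polySmooth_monomial, map_nsmul,
    wirtinger_pow_polySmooth_monomial, map_nsmul, map_nsmul, cfcSmooth_polySmooth_monomial]
  rw [star_nsmul, star_mul]
  simp only [← Nat.cast_smul_eq_nsmul ℂ, ← inv_factorial_mul_descFactorial (K := ℂ),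
    smul_mul_assoc, mul_smul_comm, smul_smul, mul_assoc]
  congr 1
  ring

end JordanCalculus

section JordanOperator

variable {H : Type*} [NormedAddCommGroup H] [InnerProductSpace ℂ H] [CompleteSpace H]

/-- The scalar distribution `f ↦ ⟨f(M + N) h, h⟩`, where `f(M + N)` is taken in the sense of
`jordanCalculus`. It is the extension of `aglerFunctional (M + N) h` to smooth functions. -/
def jordanDistribution (M N : H →L[ℂ] H) (n : ℕ) (h : H) : SmoothFunction →L[ℂ] ℂ :=
  innerSL ℂ h ∘L ContinuousLinearMap.apply ℂ H h ∘L jordanCalculus M N n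

theorem jordanDistribution_apply (M N : H →L[ℂ] H) (n : ℕ) (h : H) (f : SmoothFunction) :
    jordanDistribution M N n h f = inner ℂ h (jordanCalculus M N n f h) := rfl

theorem dsupport_jordanDistribution_subset (M N : H →L[ℂ] H) (n : ℕ) (h : H) :
    dsupport (jordanDistribution M N n h) ⊆ spectrum ℂ M := by
  refine Set.sInter_subset_of_mem ⟨fun f hf => ?_, spectrum.isClosed M⟩
  rw [jordanDistribution_apply, isVanishingOn_jordanCalculus M N n f hf, zero_apply,
    inner_zero_right]

theorem jordanDistribution_polySmooth_monomial {M N : H →L[ℂ] H} [IsStarNormal M]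
    (hMN : Commute M N) {n : ℕ} (hN : N ^ n = 0) (h : H) (k l : ℕ) :
    jordanDistribution M N n h (polySmooth (X 0 ^ k * X 1 ^ l)) =
      inner ℂ (((M + N) ^ l) h) (((M + N) ^ k) h) := by
  rw [jordanDistribution_apply, jordanCalculus_polySmooth_monomial hMN hN, mul_apply_eq_comp,
    ContinuousLinearMap.star_eq_adjoint, ContinuousLinearMap.adjoint_inner_right]

theorem mainTheorem9_general {T M N : H →L[ℂ] H} (hT : IsJordanDecomposition T M N) (h : H) :
    IsDistributionSupportedIn (aglerFunctional T h) (spectrum ℂ M) := by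
  obtain ⟨rfl, hM, ⟨n, hN⟩, hMN⟩ := hT
  refine ⟨jordanDistribution M N n h, eq_comp_polySmooth_of_monomial fun k l => ?_,
    dsupport_jordanDistribution_subset M N n h⟩
  rw [aglerFunctional_X_pow_mul, jordanDistribution_polySmooth_monomial hMN hN]

end JordanOperator

end

theorem mainTheorem9 {H : Type*} [NormedAddCommGroup H] [InnerProductSpace ℂ H]
    [CompleteSpace H] (T M N : H →L[ℂ] H) (hT : IsJordanDecomposition T M N) (h : H) :
    IsDistributionSupportedIn (aglerFunctional T h) (closedConvexHull ℝ (spectrum ℂ M)) :=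
  (mainTheorem9_general hT h).mono subset_closedConvexHull
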